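/- **Conventions.** A class of groups is closed under isomorphism. A class $\mathcal C$ of groups is a *root class* if it contains a non-trivial group and is closed under taking subgroups, extensions, and Cartesian products $\prod_{y\in Y}X_y$, where $X,Y\in\mathcal C$ and $X_y\cong X$ for each $y\in Y$. If $\mathcal C$ consists only of periodic groups, $\mathfrak P(\mathcal C)$ is the set of primes dividing the order of an element of some $\mathcal C$-group, and $\mathfrak P(\mathcal C)'$ is the set of all other primes; a $\mathfrak P(\mathcal C)'$-*number* is a positive integer all of whose prime divisors lie in $\mathfrak P(\mathcal C)'$. An abelian group $A$ is $\mathcal C$-*bounded* if, for every quotient group $B$ of $A$ and every $p\in\mathfrak P(\mathcal C)$, the $p$-power torsion subgroup of $B$ has finite exponent and cardinality not exceeding the cardinality of some $\mathcal C$-group. A nilpotent group is $\mathcal C$-*bounded* if it has a finite central series all of whose factors are $\mathcal C$-bounded abelian groups. Let $Y$ be a subgroup of a group $X$. It is $\mathcal C$-*separable* in $X$ if for every $x\in X\setminus Y$ there is a homomorphism $\sigma$ of $X$ onto a $\mathcal C$-group with $x\sigma\notin Y\sigma$. It is $\mathfrak P(\mathcal C)'$-*isolated* in $X$ if $x\in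 X$, $q\in\mathfrak P(\mathcal C)'$ and $x^q\in Y$ imply $x\in Y$. The $\mathfrak P(\mathcal C)'$-*isolator* $\mathfrak P(\mathcal C)'\text{-}\mathfrak{Is}(X,Y)$ is the smallest $\mathfrak P(\mathcal C)'$-isolated subgroup of $X$ containing $Y$, and $\mathfrak P(\mathcal C)'\text{-}\mathfrak{Rt}(X,Y)$ is the set of all $x\in X$ such that $x^q\in Y$ for some $\mathfrak P(\mathcal C)'$-number $q$. The group $X$ has the property $\mathcal C\text{-}\mathfrak{Sep}$ if all its $\mathfrak P(\mathcal C)'$-isolated subgroups are $\mathcal C$-separable, and it is $\mathfrak P(\mathcal C)'$-*torsion-free* if its trivial subgroup is $\mathfrak P(\mathcal C)'$-isolated. **Theorem 2.2.** Suppose that $\mathcal C$ is a root class of groups consisting only of periodic groups, $X$ is a $\mathcal C$-bounded nilpotent group, and $Y$ is a subgroup of $X$. Then the isolator $\mathfrak P(\mathcal C)'\text{-}\mathfrak{Is}(X,Y)$ is $\mathcal C$-separable in $X$ and coincides with the set $\mathfrak P(\mathcal C)'\text{-}\mathfrak{Rt}(X,Y)$. In particular, $X$ has the property $\mathcal C\text{-}\mathfrak{Sep}$.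 If $X$ is $\mathfrak P(\mathcal C)'$-torsion-free, then $Y$ and $\mathfrak P(\mathcal C)'\text{-}\mathfrak{Is}(X,Y)$ have the same nilpotency class. -/

import Mathlib

universe u

/-- A class of groups (in a fixed universe): a property of groups that is invariant under
isomorphism. -/
structure GroupClass where
  /-- `C.Mem G` says that the group `G` belongs to the class `C`. -/
  Mem : (G : Type u) → [Group G] → Prop
  mem_of_mulEquiv : ∀ {G H : Type u} [Group G] [Group H], (G ≃* H) → Mem G → Mem H

namespace GroupClass

/-- A root class of groups: it contains a non-trivial group and is closed under taking subgroups,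
extensions, and Cartesian powers `∏_{y ∈ Y} X` of a `C`-group `X` indexed by (the elements of)
a `C`-group `Y`. -/
structure IsRoot (C : GroupClass.{u}) : Prop where
  exists_nontrivial : ∃ (G : Type u) (_ : Group G), C.Mem G ∧ Nontrivial G
  subgroup : ∀ (G : Type u) [Group G] (H : Subgroup G), C.Mem G → C.Mem H
  extension : ∀ (G : Type u) [Group G] (N : Subgroup G) [N.Normal],
    C.Mem N → C.Mem (G ⧸ N) → C.Mem G
  cartesianPower : ∀ (X Y : Type u) [Group X] [Group Y], C.Mem X → C.Mem Y → C.Mem (Y → X)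

/-- The class consists only of periodic groups. -/
def IsPeriodic (C : GroupClass.{u}) : Prop :=
  ∀ (G : Type u) [Group G], C.Mem G → IsMulTorsion G

/-- For a class `C` of periodic groups, the set of all primes that divide the order of an element
of some `C`-group. -/
def primes (C : GroupClass.{u}) : Set ℕ :=
  {p | p.Prime ∧ ∃ (G : Type u) (_ : Group G), C.Mem G ∧ ∃ g : G, p ∣ orderOf g}

/-- The set of all primes that do not belong to `C.primes`. -/
def coprimes (C : GroupClass.{u}) : Set ℕ := {q | q.Prime ∧ q ∉ C.primes}

/-- A subgroup `Y` of `X` is separable by `C`: every element outside `Y` is separated from `Y`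
by a homomorphism of `X` onto a `C`-group. -/
def IsSeparable (C : GroupClass.{u}) {X : Type u} [Group X] (Y : Subgroup X) : Prop :=
  ∀ x : X, x ∉ Y → ∃ (G : Type u) (_ : Group G) (σ : X →* G),
    C.Mem G ∧ Function.Surjective σ ∧ σ x ∉ Y.map σ

end GroupClass

/-- A subgroup `Y` is isolated with respect to a set `Q` of primes: `x ^ q ∈ Y` with `q ∈ Q`
implies `x ∈ Y`. -/
def IsIsolatedFor (Q : Set ℕ) {X : Type*} [Group X] (Y : Subgroup X) : Prop :=
  ∀ x : X, ∀ q ∈ Q, x ^ q ∈ Y → x ∈ Y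

/-- The group `X` has no `Q`-torsion: its trivial subgroup is `Q`-isolated. -/
def HasNoTorsionFor (Q : Set ℕ) (X : Type*) [Group X] : Prop :=
  IsIsolatedFor Q (⊥ : Subgroup X)

/-- The `Q`-isolator of `Y`: the intersection of all `Q`-isolated subgroups that contain `Y`,
i.e. the smallest `Q`-isolated subgroup containing `Y`. -/
def isolatorFor (Q : Set ℕ) {X : Type*} [Group X] (Y : Subgroup X) : Subgroup X :=
  sInf {Z : Subgroup X | Y ≤ Z ∧ IsIsolatedFor Q Z}

/-- A `Q`-number: a positive integer all of whose prime divisors belong to `Q`. -/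
def IsNumberFor (Q : Set ℕ) (n : ℕ) : Prop :=
  0 < n ∧ ∀ p : ℕ, p.Prime → p ∣ n → p ∈ Q

/-- The set of `Q`-roots extracted in `X` from the elements of `Y`. -/
def rootsFor (Q : Set ℕ) {X : Type*} [Group X] (Y : Subgroup X) : Set X :=
  {x | ∃ n : ℕ, IsNumberFor Q n ∧ x ^ n ∈ Y}

/-- The `p`-power torsion elements of a group; for an abelian group, this is the underlying set
of its `p`-power torsion subgroup. -/
def powerTorsion (p : ℕ) (B : Type*) [Group B] : Set B :=
  {b | ∃ k : ℕ, b ^ (p ^ k) = 1}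

namespace GroupClass

/-- The group `X` has the property `C`-Sep: all its subgroups isolated with respect to
`C.coprimes` are separable by `C`. -/
def HasSep (C : GroupClass.{u}) (X : Type u) [Group X] : Prop :=
  ∀ Y : Subgroup X, IsIsolatedFor C.coprimes Y → C.IsSeparable Y

/-- `A` is a `C`-bounded abelian group: `A` is abelian and, in every quotient group of `A`, for
every `p ∈ C.primes`, the `p`-power torsion subgroup has finite exponent and a cardinality not
exceeding the cardinality of some `C`-group. -/
def IsBoundedAbelian (C : GroupClass.{u}) (A : Type u) [Group A] : Prop :=
  (∀ a b : A, a * b = b * a) ∧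
  ∀ (N : Subgroup A) [N.Normal], ∀ p ∈ C.primes,
    (∃ n : ℕ, 0 < n ∧ ∀ b ∈ powerTorsion p (A ⧸ N), b ^ n = 1) ∧
    ∃ (G : Type u) (_ : Group G), C.Mem G ∧
      Cardinal.mk (powerTorsion p (A ⧸ N)) ≤ Cardinal.mk G

/-- `X` is a `C`-bounded nilpotent group: `X` is nilpotent and has a finite central series
`1 = H 0 ≤ H 1 ≤ ⋯ ≤ H n = X` whose factors `H (i + 1) / H i` are `C`-bounded abelian groups. -/
def IsBoundedNilpotent (C : GroupClass.{u}) (X : Type u) [Group X] : Prop :=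
  Group.IsNilpotent X ∧
  ∃ (n : ℕ) (H : ℕ → Subgroup X) (_ : ∀ i, (H i).Normal),
    H 0 = ⊥ ∧ H n = ⊤ ∧ Monotone H ∧
    (∀ i < n, ∀ x ∈ H (i + 1), ∀ g : X, x * g * x⁻¹ * g⁻¹ ∈ H i) ∧
    ∀ i < n, C.IsBoundedAbelian (↥(H (i + 1)) ⧸ (H i).subgroupOf (H (i + 1)))

end GroupClass

/-! Modulo the next term of the lower central series, commutators are bilinear, so roots propagate:
if a group is generated by `Q`-roots of elements of `Y`, each lower central factor consists of roots
from the matching term for `Y` (`lowerCentralSeries_le_comap_centralRootsFor`). In a nilpotent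
group, descending the series shows that the roots of `Y` form a subgroup, necessarily the isolator.
Without `Q`-torsion, the same inclusion makes the lower central series of the isolator vanish as
soon as that of `Y` does.

For separability, let `x` not be a root of `Y`, and divide by a normal subgroup maximal among those
preserving this. In the quotient, any further nontrivial normal subgroup turns `x` into a root,
which forces the center to be a `p`-group with `p ∈ C.primes` (`IsRoot.exists_center_torsion`).
Boundedness gives the `p`-torsion a finite exponent, and the exponent of the center controls the
whole group. The factors of the series are then bounded abelian `p`-groups, built from elementary
ones that embed in Cartesian powers of the group of order `p`. Closure under extensions puts the
quotient itself in `C`. -/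

namespace IsNumberFor

variable {Q : Set ℕ} {m n : ℕ}

theorem one : IsNumberFor Q 1 :=
  ⟨one_pos, fun _ hp h => absurd (Nat.dvd_one.mp h) hp.ne_one⟩

theorem mul (hm : IsNumberFor Q m) (hn : IsNumberFor Q n) : IsNumberFor Q (m * n) :=
  ⟨Nat.mul_pos hm.1 hn.1, fun p hp h =>
    ((Nat.Prime.dvd_mul hp).mp h).elim (hm.2 p hp) (hn.2 p hp)⟩

theorem of_prime (hn : n.Prime) (h : n ∈ Q) : IsNumberFor Q n :=
  ⟨hn.pos, fun p hp hpn => by rwa [(Nat.prime_dvd_prime_iff_eq hp hn).mp hpn]⟩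

theorem of_dvd (hn : IsNumberFor Q n) (h : m ∣ n) : IsNumberFor Q m :=
  ⟨Nat.pos_of_dvd_of_pos h hn.1, fun p hp hpm => hn.2 p hp (hpm.trans h)⟩

end IsNumberFor

/-! ### Roots, isolators and nilpotency class -/

section Roots

variable {G : Type*} [Group G] {Q : Set ℕ}

theorem IsIsolatedFor.mem_of_pow_mem {Y : Subgroup G} (hY : IsIsolatedFor Q Y) {n : ℕ}
    (hn : IsNumberFor Q n) {x : G} (hx : x ^ n ∈ Y) : x ∈ Y := by
  induction n using Nat.strong_induction_on generalizing x with
  | _ n ih =>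
    by_cases h1 : n = 1
    · simpa [h1] using hx
    · obtain ⟨p, hp, k, rfl⟩ := Nat.exists_prime_and_dvd h1
      have hk : k < p * k := by
        have := hn.1
        have := hp.two_le
        nlinarith [Nat.pos_of_mul_pos_left hn.1]
      refine hY x p (hn.2 p hp (dvd_mul_right p k)) (ih k hk (hn.of_dvd (dvd_mul_left k p)) ?_)
      rwa [← pow_mul]

theorem isIsolatedFor_isolatorFor (Q : Set ℕ) (Y : Subgroup G) :
    IsIsolatedFor Q (isolatorFor Q Y) := by
  intro x q hq hx
  refine Subgroup.mem_sInf.mpr fun Z hZ => hZ.2 x q hq ?_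
  exact Subgroup.mem_sInf.mp hx Z hZ

theorem le_isolatorFor (Q : Set ℕ) (Y : Subgroup G) : Y ≤ isolatorFor Q Y :=
  le_sInf fun _ hZ => hZ.1

theorem rootsFor_subset_isolatorFor (Q : Set ℕ) (Y : Subgroup G) :
    rootsFor Q Y ⊆ isolatorFor Q Y := fun _ ⟨_, hn, hx⟩ =>
  (isIsolatedFor_isolatorFor Q Y).mem_of_pow_mem hn (le_isolatorFor Q Y hx)

theorem mem_rootsFor_of_mem {Y : Subgroup G} {x : G} (hx : x ∈ Y) : x ∈ rootsFor Q Y :=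
  ⟨1, .one, by simpa using hx⟩

theorem mem_rootsFor_of_pow_mem {Y : Subgroup G} {x : G} {n : ℕ} (hn : IsNumberFor Q n)
    (hx : x ^ n ∈ rootsFor Q Y) : x ∈ rootsFor Q Y := by
  obtain ⟨m, hm, h⟩ := hx
  exact ⟨n * m, hn.mul hm, by rwa [pow_mul]⟩

/-- The central elements of a group that are `Q`-roots of elements of a given subgroup. -/
def centralRootsFor (Q : Set ℕ) (H : Subgroup G) : Subgroup G where
  carrier := {g | g ∈ Subgroup.center G ∧ g ∈ rootsFor Q H}
  one_mem' := ⟨one_mem _, mem_rootsFor_of_mem (one_mem _)⟩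
  mul_mem' := by
    rintro a b ⟨ha, m, hm, ham⟩ ⟨hb, n, hn, hbn⟩
    refine ⟨mul_mem ha hb, m * n, hm.mul hn, ?_⟩
    rw [Commute.mul_pow (Subgroup.mem_center_iff.mp hb a)]
    refine mul_mem ?_ ?_
    · rw [pow_mul]; exact pow_mem ham n
    · rw [mul_comm, pow_mul]; exact pow_mem hbn m
  inv_mem' := by
    rintro a ⟨ha, m, hm, ham⟩
    exact ⟨inv_mem ha, m, hm, by rw [inv_pow]; exact inv_mem ham⟩

open commutatorElement

theorem commutatorElement_mul_right_of_mem_center {a b c : G}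
    (h : ⁅a, c⁆ ∈ Subgroup.center G) : ⁅a, b * c⁆ = ⁅a, b⁆ * ⁅a, c⁆ := by
  have := Subgroup.mem_center_iff.mp h b
  calc ⁅a, b * c⁆ = ⁅a, b⁆ * (b * ⁅a, c⁆) * b⁻¹ := by simp only [commutatorElement_def]; group
    _ = _ := by rw [this]; group

theorem commutatorElement_mul_left_of_mem_center {a b c : G}
    (h : ⁅b, c⁆ ∈ Subgroup.center G) : ⁅a * b, c⁆ = ⁅a, c⁆ * ⁅b, c⁆ := by
  have := Subgroup.mem_center_iff.mp h a
  have h2 := Subgroup.mem_center_iff.mp h ⁅a, c⁆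
  calc ⁅a * b, c⁆ = (a * ⁅b, c⁆) * a⁻¹ * ⁅a, c⁆ := by simp only [commutatorElement_def]; group
    _ = ⁅b, c⁆ * ⁅a, c⁆ := by rw [this]; group
    _ = _ := h2.symm

theorem commutatorElement_pow_right_of_mem_center {a b : G}
    (h : ⁅a, b⁆ ∈ Subgroup.center G) (n : ℕ) : ⁅a, b ^ n⁆ = ⁅a, b⁆ ^ n := by
  induction n with
  | zero => simp
  | succ n ih => rw [pow_succ, commutatorElement_mul_right_of_mem_center h, ih, pow_succ]

theorem commutatorElement_pow_left_of_mem_center {a b : G}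
    (h : ⁅a, b⁆ ∈ Subgroup.center G) (n : ℕ) : ⁅a ^ n, b⁆ = ⁅a, b⁆ ^ n := by
  induction n with
  | zero => simp
  | succ n ih => rw [pow_succ, commutatorElement_mul_left_of_mem_center h, ih, pow_succ]

/-- Commutators with `g` fall into the next term; this centrality is what makes commutators bilinear
below. -/
theorem mk_mem_center_of_mem_lowerCentralSeries {i : ℕ} {g : G}
    (hg : g ∈ (⊤ : Subgroup G).lowerCentralSeries i) :
    QuotientGroup.mk' ((⊤ : Subgroup G).lowerCentralSeries (i + 1)) g ∈ Subgroup.center _ := by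
  rw [← Subgroup.mem_comap, ← Subgroup.upperCentralSeriesStep_eq_comap_center]
  exact fun y => Subgroup.commutator_mem_commutator hg (Subgroup.mem_top y)

/-- If a group is generated by `Q`-roots of elements of a subgroup `Y`, then each term of its
lower central series consists, modulo the next term, of `Q`-roots of elements of the corresponding
term of the lower central series of `Y`. -/
theorem lowerCentralSeries_le_comap_centralRootsFor {Y : Subgroup G} {S : Set G}
    (hS : Subgroup.closure S = ⊤) (hSY : S ⊆ rootsFor Q Y) (i : ℕ) :
    (⊤ : Subgroup G).lowerCentralSeries i ≤
      (centralRootsFor Q ((Y.lowerCentralSeries i).map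
        (QuotientGroup.mk' ((⊤ : Subgroup G).lowerCentralSeries (i + 1))))).comap
        (QuotientGroup.mk' ((⊤ : Subgroup G).lowerCentralSeries (i + 1))) := by
  induction i with
  | zero =>
    refine hS.ge.trans ((Subgroup.closure_le _).mpr fun s hs => ?_)
    obtain ⟨n, hn, h⟩ := hSY hs
    refine ⟨mk_mem_center_of_mem_lowerCentralSeries (i := 0) (Subgroup.mem_top s), n, hn, ?_⟩
    rw [← map_pow]
    exact Subgroup.mem_map_of_mem _ h
  | succ i ih =>
    set π := QuotientGroup.mk' ((⊤ : Subgroup G).lowerCentralSeries (i + 1 + 1))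
    have hc : ∀ a ∈ (⊤ : Subgroup G).lowerCentralSeries i, ∀ x : G,
        ⁅π a, π x⁆ ∈ Subgroup.center _ := by
      intro a ha x
      rw [← map_commutatorElement]
      exact mk_mem_center_of_mem_lowerCentralSeries
        (Subgroup.commutator_mem_commutator ha (Subgroup.mem_top x))
    rw [Subgroup.lowerCentralSeries_succ, Subgroup.commutator_le]
    intro g hg x _
    obtain ⟨-, n, hn, h, hh, hgh⟩ := ih hg
    have hh' := Subgroup.lowerCentralSeries_mono i (le_top (a := Y)) hh
    rw [← map_pow, QuotientGroup.mk'_eq_mk'] at hgh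
    obtain ⟨c, hcm, hgc⟩ := hgh
    rw [Subgroup.mem_comap, map_commutatorElement]
    -- With `h` fixed, commutation with `h` is a homomorphism in `x`, so it suffices to treat the
    -- generators in `S`.
    have hroot : ⁅π h, π x⁆ ∈ centralRootsFor Q ((Y.lowerCentralSeries (i + 1)).map π) := by
      have hx : x ∈ Subgroup.closure S := hS ▸ Subgroup.mem_top x
      induction hx using Subgroup.closure_induction with
      | mem s hs =>
        obtain ⟨m, hm, hsm⟩ := hSY hs
        refine ⟨hc h hh' s, m, hm, ?_⟩
        rw [← commutatorElement_pow_right_of_mem_center (hc h hh' s), ← map_pow,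
          ← map_commutatorElement]
        exact Subgroup.mem_map_of_mem _ (Subgroup.commutator_mem_commutator hh hsm)
      | one => rw [map_one, commutatorElement_one_right]; exact one_mem _
      | mul y z _ _ hy hz =>
        rw [map_mul, commutatorElement_mul_right_of_mem_center (hc h hh' z)]
        exact mul_mem (hy trivial) (hz trivial)
      | inv y _ hy =>
        have h1 := commutatorElement_mul_right_of_mem_center (b := π y) (hc h hh' y⁻¹)
        rw [← map_mul, mul_inv_cancel, map_one, commutatorElement_one_right] at h1
        rw [eq_inv_of_mul_eq_one_right h1.symm]
        exact inv_mem (hy trivial)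
    refine ⟨hc g hg x, mem_rootsFor_of_pow_mem hn ?_⟩
    -- The discrepancy `c` between `g ^ n` and `h` is central modulo the smaller term, so it does
    -- not affect the commutator.
    have hcx : ⁅π c, π x⁆ = 1 := by
      rw [commutatorElement_eq_one_iff_mul_comm]
      exact (Subgroup.mem_center_iff.mp (mk_mem_center_of_mem_lowerCentralSeries hcm) _).symm
    have : ⁅π g, π x⁆ ^ n = ⁅π h, π x⁆ := by
      rw [← commutatorElement_pow_left_of_mem_center (hc g hg x), ← map_pow, ← hgc, map_mul,
        commutatorElement_mul_left_of_mem_center (hcx ▸ one_mem _), hcx, mul_one]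
    rw [this]
    exact hroot.2

/-- A nilpotent group generated by `Q`-roots of elements of a subgroup consists of such roots. -/
theorem rootsFor_eq_univ_of_closure_eq_top [Group.IsNilpotent G] {Y : Subgroup G} {S : Set G}
    (hS : Subgroup.closure S = ⊤) (hSY : S ⊆ rootsFor Q Y) (x : G) : x ∈ rootsFor Q Y := by
  -- Some power of `x` lies in `Y` up to an error `g`; raising to further `Q`-numbers pushes the
  -- error down the series.
  have key : ∀ i : ℕ, ∃ n, IsNumberFor Q n ∧
      ∃ y ∈ Y, ∃ g ∈ (⊤ : Subgroup G).lowerCentralSeries i, y * g = x ^ n := by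
    intro i
    induction i with
    | zero => exact ⟨1, .one, 1, one_mem _, x, Subgroup.mem_top x, by simp⟩
    | succ i ih =>
      obtain ⟨n, hn, y, hy, g, hg, h⟩ := ih
      obtain ⟨hgc, m, hm, z, hz, hgz⟩ := lowerCentralSeries_le_comap_centralRootsFor hS hSY i hg
      have : QuotientGroup.mk' ((⊤ : Subgroup G).lowerCentralSeries (i + 1)) (y ^ m * z) =
          QuotientGroup.mk' _ (x ^ (n * m)) := by
        rw [pow_mul, ← h, map_mul, hgz, map_pow, map_pow _ (y * g), map_mul,
          Commute.mul_pow (Subgroup.mem_center_iff.mp hgc _)]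
      obtain ⟨c, hc, h'⟩ := (QuotientGroup.mk'_eq_mk' _).mp this
      exact ⟨n * m, hn.mul hm, y ^ m * z,
        mul_mem (pow_mem hy m) (Y.lowerCentralSeries_le_self i hz), c, hc, h'⟩
  obtain ⟨n, hn, y, hy, g, hg, h⟩ := key (Group.nilpotencyClass G)
  rw [Subgroup.lowerCentralSeries_nilpotencyClass, Subgroup.mem_bot] at hg
  refine ⟨n, hn, ?_⟩
  rw [← h, hg, mul_one]
  exact hy

/-- The subgroup generated by the roots is itself nilpotent, so the preceding result applies inside
it. -/
theorem closure_rootsFor_subset [Group.IsNilpotent G] (Y : Subgroup G) :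
    (Subgroup.closure (rootsFor Q Y) : Set G) ⊆ rootsFor Q Y := by
  intro x hx
  set W := Subgroup.closure (rootsFor Q Y)
  have h := rootsFor_eq_univ_of_closure_eq_top (G := W) (Q := Q) (Y := Y.subgroupOf W)
    (Subgroup.closure_closure_coe_preimage (k := rootsFor Q Y))
    (fun s ⟨n, hn, hs⟩ => ⟨n, hn, by simpa [Subgroup.mem_subgroupOf] using hs⟩) ⟨x, hx⟩
  obtain ⟨n, hn, hs⟩ := h
  exact ⟨n, hn, by simpa [Subgroup.mem_subgroupOf] using hs⟩

/-- In a nilpotent group, the `Q`-isolator of a subgroup consists of the `Q`-roots of its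
elements. -/
theorem coe_isolatorFor_eq_rootsFor [Group.IsNilpotent G] (hQ : ∀ q ∈ Q, q.Prime)
    (Y : Subgroup G) : (isolatorFor Q Y : Set G) = rootsFor Q Y := by
  refine Set.Subset.antisymm (fun x hx => ?_) (rootsFor_subset_isolatorFor Q Y)
  refine closure_rootsFor_subset Y (Subgroup.mem_sInf.mp hx _
    ⟨fun y hy => Subgroup.subset_closure (mem_rootsFor_of_mem hy), fun x q hq hxq => ?_⟩)
  exact Subgroup.subset_closure (mem_rootsFor_of_pow_mem (.of_prime (hQ q hq) hq)
    (closure_rootsFor_subset Y hxq))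

/-- If a nilpotent group without `Q`-torsion consists of `Q`-roots of elements of a subgroup, then
its nilpotency class does not exceed that of the subgroup. -/
theorem nilpotencyClass_le_of_rootsFor_eq_univ [Group.IsNilpotent G] (hG : HasNoTorsionFor Q G)
    {Y : Subgroup G} (hY : rootsFor Q Y = Set.univ) :
    Group.nilpotencyClass G ≤ Group.nilpotencyClass Y := by
  rw [← Subgroup.lowerCentralSeries_eq_bot_iff_nilpotencyClass_le]
  have hbot : Y.lowerCentralSeries (Group.nilpotencyClass Y) = ⊥ := by
    rw [← Subgroup.top_subtype_lowerCentralSeries, Subgroup.lowerCentralSeries_nilpotencyClass,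
      Subgroup.map_bot]
  -- Starting at the maximum of both classes guarantees a vanishing term at an index from which one
  -- can descend to the class of `Y`.
  refine Nat.decreasingInduction' (m := Group.nilpotencyClass Y)
    (n := max (Group.nilpotencyClass Y) (Group.nilpotencyClass G))
    (P := fun i => (⊤ : Subgroup G).lowerCentralSeries i = ⊥) (fun i _ hi ih => ?_)
    (le_max_left _ _)
    (Subgroup.lowerCentralSeries_eq_bot_iff_nilpotencyClass_le.mpr (le_max_right _ _))
  rw [eq_bot_iff]
  intro g hg
  obtain ⟨-, n, hn, h, hh, hgh⟩ := lowerCentralSeries_le_comap_centralRootsFor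
    Subgroup.closure_univ hY.ge i hg
  have hh1 : h = 1 := Subgroup.mem_bot.mp (hbot ▸ Y.lowerCentralSeries_antitone hi hh)
  rw [← map_pow, QuotientGroup.mk'_eq_mk'] at hgh
  obtain ⟨c, hc, hgc⟩ := hgh
  rw [ih, Subgroup.mem_bot] at hc
  refine hG.mem_of_pow_mem hn ?_
  rw [← hgc, hh1, hc, one_mul, Subgroup.mem_bot]

/-- In a nilpotent group without `Q`-torsion, the `Q`-isolator of a subgroup has the same
nilpotency class as the subgroup. -/
theorem nilpotencyClass_isolatorFor [Group.IsNilpotent G] (hQ : ∀ q ∈ Q, q.Prime)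
    (hG : HasNoTorsionFor Q G) (Y : Subgroup G) :
    Group.nilpotencyClass (isolatorFor Q Y) = Group.nilpotencyClass Y := by
  set I := isolatorFor Q Y with hI
  have hYI : Y ≤ I := le_isolatorFor Q Y
  have e : Y.subgroupOf I ≃* Y := Subgroup.subgroupOfEquivOfLe hYI
  have he : Group.nilpotencyClass (Y.subgroupOf I) = Group.nilpotencyClass Y :=
    le_antisymm (Group.nilpotencyClass_le_of_surjective e.symm.toMonoidHom e.symm.surjective)
      (Group.nilpotencyClass_le_of_surjective e.toMonoidHom e.surjective)
  rw [← he]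
  refine le_antisymm (nilpotencyClass_le_of_rootsFor_eq_univ (Q := Q) ?_ ?_)
    (Subgroup.nilpotencyClass_le _)
  · intro x q hq hx
    have := hG (x : G) q hq (congrArg Subtype.val (Subgroup.mem_bot.mp hx))
    exact Subtype.ext this
  · refine Set.eq_univ_of_forall fun x => ?_
    have hx : (x : G) ∈ rootsFor Q Y := by
      rw [← coe_isolatorFor_eq_rootsFor hQ]
      exact x.2
    obtain ⟨n, hn, h⟩ := hx
    exact ⟨n, hn, by simpa [Subgroup.mem_subgroupOf] using h⟩

end Roots

namespace GroupClass

/-! ### Abelian `p`-groups in a root class -/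

section RootClasses

variable {C : GroupClass.{u}}

theorem IsRoot.mem_of_injective (hC : C.IsRoot) {G H : Type u} [Group G] [Group H] (f : H →* G)
    (hf : Function.Injective f) (hG : C.Mem G) : C.Mem H :=
  C.mem_of_mulEquiv (MonoidHom.ofInjective hf).symm (hC.subgroup G f.range hG)

theorem IsRoot.mem_of_subsingleton (hC : C.IsRoot) (H : Type u) [Group H] [Subsingleton H] :
    C.Mem H := by
  obtain ⟨G, _, hG, -⟩ := hC.exists_nontrivial
  exact hC.mem_of_injective (1 : H →* G) (Function.injective_of_subsingleton _) hG

theorem IsRoot.mem_of_ker_of_range (hC : C.IsRoot) {G K : Type u} [Group G] [Group K] (f : G →* K)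
    (hker : C.Mem f.ker) (hrange : C.Mem f.range) : C.Mem G :=
  hC.extension G f.ker hker
    (C.mem_of_mulEquiv (QuotientGroup.quotientKerEquivRange f).symm hrange)

theorem IsRoot.exists_mem_primes (hC : C.IsRoot) : ∃ p, p ∈ C.primes := by
  obtain ⟨G, _, hG, hn⟩ := hC.exists_nontrivial
  obtain ⟨g, hg⟩ := exists_ne (1 : G)
  obtain ⟨p, hp, hpg⟩ := Nat.exists_prime_and_dvd (mt orderOf_eq_one_iff.mp hg)
  exact ⟨p, hp, G, _, hG, g, hpg⟩

theorem IsRoot.mem_zmod (hC : C.IsRoot) (hper : C.IsPeriodic) {p : ℕ} (hp : p ∈ C.primes) :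
    C.Mem (Multiplicative (ULift.{u} (ZMod p))) := by
  obtain ⟨hpp, G, _, hG, g, hpg⟩ := hp
  have : Fact p.Prime := ⟨hpp⟩
  have ho : orderOf g ≠ 0 := (hper G hG g).orderOf_pos.ne'
  have h1 : Nat.card (Subgroup.zpowers (g ^ (orderOf g / p))) = p := by
    rw [Nat.card_zpowers, orderOf_pow_orderOf_div ho hpg]
  have h2 : Nat.card (Multiplicative (ULift.{u} (ZMod p))) = p := by
    rw [Nat.card_congr (Multiplicative.toAdd.trans Equiv.ulift), Nat.card_zmod]
  exact C.mem_of_mulEquiv (mulEquivOfPrimeCardEq h1 h2) (hC.subgroup G _ hG)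

theorem _root_.ZMod.exists_addMonoidHom_ne_zero {V : Type*} [AddCommGroup V] {p : ℕ}
    [Fact p.Prime] (hV : ∀ v : V, p • v = 0) {v : V} (hv : v ≠ 0) :
    ∃ φ : V →+ ZMod p, φ v ≠ 0 := by
  have := AddCommGroup.zmodModule hV
  obtain ⟨φ, h⟩ := Module.Projective.exists_dual_ne_zero (ZMod p) hv
  exact ⟨φ.toAddMonoidHom, h⟩

/-- An elementary abelian `p`-group with `p ∈ C.primes` whose cardinality is bounded by that of a
`C`-group is a `C`-group. -/
theorem IsRoot.mem_of_elementary (hC : C.IsRoot) (hper : C.IsPeriodic) {p : ℕ}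
    (hp : p ∈ C.primes) {E G : Type u} [CommGroup E] [Group G] (hG : C.Mem G)
    (hE : ∀ e : E, e ^ p = 1) (hEG : Cardinal.mk E ≤ Cardinal.mk G) : C.Mem E := by
  have : Fact p.Prime := ⟨hp.1⟩
  obtain ⟨ι⟩ := hEG
  -- As `G` surjects onto `E`, functionals indexed by `G` suffice to detect every nontrivial
  -- element.
  have hs := Function.invFun_surjective ι.injective
  have hφ : ∀ e : Additive E, ∃ φ : Additive E →+ ZMod p, e ≠ 0 → φ e ≠ 0 := by
    intro e
    by_cases he : e = 0
    · exact ⟨0, fun h => absurd he h⟩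
    · obtain ⟨φ, h⟩ := ZMod.exists_addMonoidHom_ne_zero
        (fun v : Additive E => hE v.toMul) he
      exact ⟨φ, fun _ => h⟩
  choose φ hφ using hφ
  let f : E →* (G → Multiplicative (ULift.{u} (ZMod p))) :=
    { toFun := fun e g =>
        Multiplicative.ofAdd (ULift.up (φ (Additive.ofMul (Function.invFun ι g)) (.ofMul e)))
      map_one' := by ext g; simp
      map_mul' := fun a b => by ext g; simp }
  refine hC.mem_of_injective f ?_ (hC.cartesianPower _ G (hC.mem_zmod hper hp) hG)
  rw [injective_iff_map_eq_one]
  intro e he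
  obtain ⟨g, hg⟩ := hs e
  by_contra hne
  apply hφ (Additive.ofMul e) (fun h => hne h)
  have := congrFun he g
  simpa [f, hg] using congrArg (fun t => (Multiplicative.toAdd t).down) this

/-- Induction on the exponent via `a ↦ a ^ p`: the kernel is elementary and the image is killed by a
smaller power of `p`. -/
theorem IsRoot.mem_of_pow_prime_pow_eq_one (hC : C.IsRoot) (hper : C.IsPeriodic) {p : ℕ}
    (hp : p ∈ C.primes) {G : Type u} [Group G] (hG : C.Mem G) (k : ℕ) (A : Type u) [CommGroup A]
    (hA : ∀ a : A, a ^ p ^ k = 1) (hAG : Cardinal.mk A ≤ Cardinal.mk G) : C.Mem A := by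
  induction k generalizing A with
  | zero =>
    have : Subsingleton A := ⟨fun a b => by
      rw [← pow_one a, ← pow_one b, ← pow_zero p, hA, hA]⟩
    exact hC.mem_of_subsingleton A
  | succ k ih =>
    refine hC.mem_of_ker_of_range (powMonoidHom p : A →* A)
      (hC.mem_of_elementary hper hp hG (fun e => Subtype.ext e.2)
        ((Cardinal.mk_subtype_le _).trans hAG))
      (ih _ ?_ ((Cardinal.mk_subtype_le _).trans hAG))
    rintro ⟨_, a, rfl⟩
    apply Subtype.ext
    simpa [← pow_mul, ← pow_succ'] using hA a

end RootClasses

/-! ### Bounded abelian and nilpotent groups -/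

section Bounded

variable {C : GroupClass.{u}}

theorem IsBoundedAbelian.of_surjective {A B : Type u} [Group A] [Group B]
    (hA : C.IsBoundedAbelian A) (f : A →* B) (hf : Function.Surjective f) :
    C.IsBoundedAbelian B := by
  refine ⟨fun a b => ?_, fun N _ p hp => ?_⟩
  · obtain ⟨a, rfl⟩ := hf a
    obtain ⟨b, rfl⟩ := hf b
    rw [← map_mul, hA.1, map_mul]
  · obtain ⟨⟨n, hn, h1⟩, G, _, hG, h2⟩ := hA.2 (N.comap f) p hp
    let g : A ⧸ N.comap f →* B ⧸ N := QuotientGroup.map _ _ f le_rfl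
    have hg : Function.Surjective g :=
      QuotientGroup.map_surjective_of_surjective _ _ _
        ((QuotientGroup.mk'_surjective N).comp hf) _
    have hinj : Function.Injective g := by
      rw [injective_iff_map_eq_one]
      intro a
      induction a using QuotientGroup.induction_on with
      | H a => simp [g, QuotientGroup.eq_one_iff]
    let e := MulEquiv.ofBijective g ⟨hinj, hg⟩
    have he : ∀ b ∈ powerTorsion p (B ⧸ N), e.symm b ∈ powerTorsion p (A ⧸ N.comap f) := by
      rintro b ⟨k, hk⟩
      exact ⟨k, by rw [← map_pow, hk, map_one]⟩
    refine ⟨⟨n, hn, fun b hb => e.symm.injective ?_⟩, G, _, hG, le_trans ?_ h2⟩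
    · rw [map_pow, h1 _ (he b hb), map_one]
    · exact Cardinal.mk_le_of_injective (f := fun b => ⟨e.symm b.1, he b.1 b.2⟩)
        fun a b h => Subtype.ext (e.symm.injective (congrArg Subtype.val h))

theorem IsBoundedAbelian.powerTorsion_bounded {A : Type u} [Group A] (hA : C.IsBoundedAbelian A)
    {p : ℕ} (hp : p ∈ C.primes) :
    (∃ n : ℕ, 0 < n ∧ ∀ b ∈ powerTorsion p A, b ^ n = 1) ∧
    ∃ (G : Type u) (_ : Group G), C.Mem G ∧ Cardinal.mk (powerTorsion p A) ≤ Cardinal.mk G := by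
  obtain ⟨⟨n, hn, h1⟩, G, _, hG, h2⟩ := hA.2 ⊥ p hp
  let e : A ≃* A ⧸ (⊥ : Subgroup A) := QuotientGroup.quotientBot.symm
  have he : ∀ b ∈ powerTorsion p A, e b ∈ powerTorsion p (A ⧸ (⊥ : Subgroup A)) := by
    rintro b ⟨k, hk⟩
    exact ⟨k, by rw [← map_pow, hk, map_one]⟩
  refine ⟨⟨n, hn, fun b hb => e.injective ?_⟩, G, _, hG, le_trans ?_ h2⟩
  · rw [map_pow, h1 _ (he b hb), map_one]
  · exact Cardinal.mk_le_of_injective (f := fun b => ⟨e b.1, he b.1 b.2⟩)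
      fun a b h => Subtype.ext (e.injective (congrArg Subtype.val h))

end Bounded

end GroupClass

/-- The order is `p ^ j` with `j < p ^ j ≤ n`. This turns any finite exponent into a `p`-power one.
-/
theorem pow_prime_pow_eq_one_of_pow_eq_one {G : Type*} [Monoid G] {p n k : ℕ} (hp : p.Prime)
    (hn : 0 < n) {x : G} (h1 : x ^ n = 1) (h2 : x ^ p ^ k = 1) : x ^ p ^ n = 1 := by
  obtain ⟨j, -, hj⟩ := (Nat.dvd_prime_pow hp).mp (orderOf_dvd_of_pow_eq_one h2)
  have hle : j ≤ n :=
    (Nat.lt_pow_self hp.one_lt).le.trans (hj ▸ orderOf_le_of_pow_eq_one hn h1)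
  exact orderOf_dvd_iff_pow_eq_one.mp (hj ▸ pow_dvd_pow p hle)

namespace GroupClass

section Bounded

variable {C : GroupClass.{u}}

/-- A `C`-bounded abelian `p`-group with `p ∈ C.primes` is a `C`-group. -/
theorem IsBoundedAbelian.mem (hC : C.IsRoot) (hper : C.IsPeriodic) {A : Type u} [Group A]
    (hA : C.IsBoundedAbelian A) {p : ℕ} (hp : p ∈ C.primes) (h : ∀ a : A, ∃ k : ℕ, a ^ p ^ k = 1) :
    C.Mem A := by
  obtain ⟨⟨n, hn, h1⟩, G, _, hG, h2⟩ := hA.powerTorsion_bounded hp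
  have hT : powerTorsion p A = Set.univ := Set.eq_univ_of_forall h
  rw [hT, Cardinal.mk_univ] at h2
  let : CommGroup A := { ‹Group A› with mul_comm := hA.1 }
  refine hC.mem_of_pow_prime_pow_eq_one hper hp hG n A (fun a => ?_) h2
  obtain ⟨k, hk⟩ := h a
  exact pow_prime_pow_eq_one_of_pow_eq_one hp.1 hn (h1 a (h a)) hk

theorem IsBoundedNilpotent.of_surjective {X X' : Type u} [Group X] [Group X']
    (hX : C.IsBoundedNilpotent X) (f : X →* X') (hf : Function.Surjective f) :
    C.IsBoundedNilpotent X' := by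
  obtain ⟨hnil, n, H, hN, h0, hn, hmono, hcent, hfac⟩ := hX
  refine ⟨Group.nilpotent_of_surjective f hf, n, fun i => (H i).map f,
    fun i => (hN i).map f hf, by simp [h0], ?_, fun i j hij => Subgroup.map_mono (hmono hij), ?_,
    fun i hi => ?_⟩
  · simp only [hn]
    exact Subgroup.map_top_of_surjective f hf
  · rintro i hi _ ⟨x, hx, rfl⟩ g
    obtain ⟨g, rfl⟩ := hf g
    exact ⟨_, hcent i hi x hx g, by simp⟩
  · have := (hN i).map f hf
    have hle : (H i).subgroupOf (H (i + 1)) ≤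
        (((H i).map f).subgroupOf ((H (i + 1)).map f)).comap (f.subgroupMap (H (i + 1))) :=
      fun x hx => ⟨x.1, hx, rfl⟩
    refine (hfac i hi).of_surjective (QuotientGroup.map _ _ (f.subgroupMap (H (i + 1))) hle) ?_
    exact QuotientGroup.map_surjective_of_surjective _ _ _
      ((QuotientGroup.mk'_surjective _).comp (f.subgroupMap_surjective _)) _

end Bounded

end GroupClass

/-! ### From the exponent of the center to that of the group -/

section CenterExponent

open commutatorElement

/-- Modulo a lower term, `⁅x ^ m, y⁆` is `⁅x, y⁆ ^ m`, to which induction applies since `⁅x, y⁆`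
lies one term below `x`. -/
theorem pow_mem_upperCentralSeries {G : Type*} [Group G] {m : ℕ}
    (h : ∀ z ∈ Subgroup.center G, z ^ m = 1) (i : ℕ) :
    ∀ x ∈ Subgroup.upperCentralSeries G (i + 1), x ^ m ∈ Subgroup.upperCentralSeries G i := by
  induction i with
  | zero =>
    intro x hx
    rw [zero_add, Subgroup.upperCentralSeries_one] at hx
    simpa using h x hx
  | succ i ih =>
    intro x hx
    rw [Subgroup.mem_upperCentralSeries_succ_iff] at hx ⊢
    intro y
    have hxy := hx y
    set π := QuotientGroup.mk' (Subgroup.upperCentralSeries G i)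
    have hc : ⁅π x, π y⁆ ∈ Subgroup.center _ := by
      rw [← map_commutatorElement, ← Subgroup.mem_comap,
        ← Subgroup.upperCentralSeriesStep_eq_comap_center]
      exact Subgroup.mem_upperCentralSeries_succ_iff.mp hxy
    have h2 := commutatorElement_pow_left_of_mem_center hc m
    rw [← map_pow, ← map_commutatorElement, ← map_commutatorElement, ← map_pow] at h2
    have h3 := ih _ hxy
    rw [← QuotientGroup.eq_one_iff] at h3 ⊢
    exact h2.trans h3

/-- If the center of a nilpotent group has finite exponent, then so does the group. -/
theorem pow_nilpotencyClass_eq_one {G : Type*} [Group G] [Group.IsNilpotent G] {m : ℕ}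
    (h : ∀ z ∈ Subgroup.center G, z ^ m = 1) (x : G) :
    x ^ m ^ Group.nilpotencyClass G = 1 := by
  have key : ∀ i : ℕ, ∀ x ∈ Subgroup.upperCentralSeries G i, x ^ m ^ i = 1 := by
    intro i
    induction i with
    | zero => intro x hx; simpa using hx
    | succ i ih =>
      intro x hx
      rw [pow_succ', pow_mul]
      exact ih _ (pow_mem_upperCentralSeries h i x hx)
  exact key _ x (by rw [Subgroup.upperCentralSeries_nilpotencyClass]; trivial)

end CenterExponent

/-! ### Bounded nilpotent groups with `p`-torsion center -/

namespace GroupClass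

variable {C : GroupClass.{u}}

/-- The `p`-torsion of the center of a `C`-bounded nilpotent group has finite exponent. -/
theorem IsBoundedNilpotent.exists_pow_eq_one_of_mem_center {X : Type u} [Group X]
    (hX : C.IsBoundedNilpotent X) {p : ℕ} (hp : p ∈ C.primes) :
    ∃ e : ℕ, 0 < e ∧ ∀ z ∈ powerTorsion p X, z ^ e = 1 := by
  obtain ⟨-, n, H, hN, h0, hn, -, -, hfac⟩ := hX
  have key : ∀ i ≤ n, ∃ e : ℕ, 0 < e ∧ ∀ z ∈ powerTorsion p X, z ∈ H i → z ^ e = 1 := by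
    intro i
    induction i with
    | zero => exact fun _ => ⟨1, one_pos, fun z _ hz => by simpa [h0] using hz⟩
    | succ i ih =>
      intro hi
      obtain ⟨e, he, h⟩ := ih (by omega)
      obtain ⟨⟨m, hm, hfin⟩, -⟩ := (hfac i hi).powerTorsion_bounded hp
      -- The power `z ^ m` drops one term and stays `p`-power torsion, so exponents multiply along
      -- the series.
      refine ⟨m * e, Nat.mul_pos hm he, fun z hzt hz => ?_⟩
      rw [pow_mul]
      obtain ⟨k, hk⟩ := hzt
      refine h _ ⟨k, by rw [← pow_mul, mul_comm, pow_mul, hk, one_pow]⟩ ?_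
      have := hfin (QuotientGroup.mk' _ ⟨z, hz⟩) ⟨k, by
        rw [← map_pow, Subtype.ext (a1 := (⟨z, hz⟩ : H (i + 1)) ^ p ^ k) (a2 := 1) hk, map_one]⟩
      rw [← map_pow] at this
      exact (QuotientGroup.eq_one_iff ((⟨z, hz⟩ : H (i + 1)) ^ m)).mp this
  obtain ⟨e, he, h⟩ := key n le_rfl
  exact ⟨e, he, fun z hz => h z hz (hn ▸ Subgroup.mem_top z)⟩

/-- A `C`-bounded nilpotent group whose center is a `p`-group with `p ∈ C.primes` is a
`C`-group. -/
theorem IsBoundedNilpotent.mem_of_center (hC : C.IsRoot) (hper : C.IsPeriodic) {X : Type u}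
    [Group X] (hX : C.IsBoundedNilpotent X) {p : ℕ} (hp : p ∈ C.primes)
    (hcent : ∀ z ∈ Subgroup.center X, ∃ k : ℕ, z ^ p ^ k = 1) : C.Mem X := by
  obtain ⟨e, he, hexp⟩ := hX.exists_pow_eq_one_of_mem_center hp
  obtain ⟨hnil, n, H, hN, h0, hn, hmono, -, hfac⟩ := hX
  have hpow : ∀ x : X, ∃ k : ℕ, x ^ p ^ k = 1 := fun x =>
    ⟨_, by
      rw [pow_mul]
      refine pow_nilpotencyClass_eq_one (m := p ^ e) (fun z hz => ?_) x
      obtain ⟨k, hk⟩ := hcent z hz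
      exact pow_prime_pow_eq_one_of_pow_eq_one hp.1 he (hexp z ⟨k, hk⟩) hk⟩
  have key : ∀ i ≤ n, C.Mem (H i) := by
    intro i
    induction i with
    | zero =>
      intro _
      rw [h0]
      exact hC.mem_of_subsingleton _
    | succ i ih =>
      intro hi
      refine hC.extension _ ((H i).subgroupOf (H (i + 1)))
        (C.mem_of_mulEquiv (Subgroup.subgroupOfEquivOfLe (hmono (Nat.le_succ i))).symm
          (ih (by omega))) ((hfac i hi).mem hC hper hp fun a => ?_)
      induction a using QuotientGroup.induction_on with
      | H a =>
        obtain ⟨k, hk⟩ := hpow a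
        refine ⟨k, ?_⟩
        rw [← QuotientGroup.mk_pow, Subtype.ext (a1 := a ^ p ^ k) (a2 := 1) hk,
          QuotientGroup.mk_one]
  have := key n le_rfl
  rw [hn] at this
  exact C.mem_of_mulEquiv Subgroup.topEquiv this

end GroupClass

/-! ### Separation through a maximal normal subgroup -/

theorem Subgroup.zpowers_normal_of_mem_center {G : Type*} [Group G] {w : G}
    (hw : w ∈ Subgroup.center G) : (Subgroup.zpowers w).Normal :=
  ⟨fun n hn g => by
    have hnc : n ∈ Subgroup.center G := (Subgroup.zpowers_le.mpr hw) hn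
    rwa [Subgroup.mem_center_iff.mp hnc g, mul_inv_cancel_right]⟩

/-- If an element `t` of prime order `p` lies in the cyclic subgroup generated by each nontrivial
power of `w`, then the order of `w` is a power of `p`. -/
theorem exists_pow_prime_pow_eq_one_of_mem_zpowers {G : Type*} [Group G] {p : ℕ} (hp : p.Prime)
    {t w : G} (ht : orderOf t = p) (h : ∀ n : ℕ, w ^ n ≠ 1 → t ∈ Subgroup.zpowers (w ^ n)) :
    ∃ k : ℕ, w ^ p ^ k = 1 := by
  by_cases hw : w = 1
  · exact ⟨0, by simp [hw]⟩
  have ht1 : t ≠ 1 := fun h1 => hp.ne_one (by rw [← ht, h1, orderOf_one])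
  have hfin : orderOf w ≠ 0 := by
    intro h0
    obtain ⟨k, hk⟩ := Subgroup.mem_zpowers_iff.mp (h 1 (by simpa using hw))
    rw [pow_one] at hk
    have hkp : w ^ (k * p) = 1 := by
      rw [zpow_mul, hk, zpow_natCast, ← ht, pow_orderOf_eq_one]
    have h1 := orderOf_dvd_iff_zpow_eq_one.mpr hkp
    rw [h0, Nat.cast_zero, zero_dvd_iff, mul_eq_zero] at h1
    rcases h1 with h1 | h1
    · exact ht1 (by rw [← hk, h1, zpow_zero])
    · exact hp.ne_zero (by exact_mod_cast h1)
  -- If `w ^ p ^ k` were nontrivial, `t` would be a power of it and `t ^ m = 1`, although `p` does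
  -- not divide `m`.
  obtain ⟨k, m, hm, hkm⟩ := Nat.exists_eq_pow_mul_and_not_dvd hfin p hp.ne_one
  refine ⟨k, ?_⟩
  by_contra hne
  obtain ⟨j, hj⟩ := Subgroup.mem_zpowers_iff.mp (h _ hne)
  apply hm
  rw [← ht]
  refine orderOf_dvd_of_pow_eq_one ?_
  rw [← hj, ← zpow_natCast, ← zpow_mul, mul_comm, zpow_mul, zpow_natCast, ← pow_mul, ← hkm,
    pow_orderOf_eq_one, one_zpow]

namespace GroupClass

variable {C : GroupClass.{u}}

theorem coprime_of_isNumberFor_coprimes {p n : ℕ} (hp : p ∈ C.primes)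
    (hn : IsNumberFor C.coprimes n) : p.Coprime n :=
  (Nat.Prime.coprime_iff_not_dvd hp.1).mpr fun h => (hn.2 p hp.1 h).2 hp

/-- If `x` is not a `C.coprimes`-root of an element of `Y`, but becomes such a root after enlarging
`Y` by any nontrivial normal subgroup, then the center is a `p`-group for some `p ∈ C.primes`. -/
theorem IsRoot.exists_center_torsion (hC : C.IsRoot) {X : Type*} [Group X] [Group.IsNilpotent X]
    {Y : Subgroup X} {x : X} (hx : x ∉ rootsFor C.coprimes Y)
    (hM : ∀ M : Subgroup X, M.Normal → M ≠ ⊥ → x ∈ rootsFor C.coprimes (Y ⊔ M)) :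
    ∃ p ∈ C.primes, ∀ w ∈ Subgroup.center X, ∃ k : ℕ, w ^ p ^ k = 1 := by
  have hx1 : x ≠ 1 := fun h => hx (h ▸ mem_rootsFor_of_mem (one_mem _))
  have : Nontrivial X := ⟨x, 1, hx1⟩
  -- Adjoining a central cyclic subgroup already inside `Y` enlarges nothing, so it must be trivial.
  have hYZ : ∀ u ∈ Y, u ∈ Subgroup.center X → u = 1 := by
    intro u hu huc
    by_contra hne
    have := hM _ (Subgroup.zpowers_normal_of_mem_center huc) (mt Subgroup.zpowers_eq_bot.mp hne)
    rw [sup_eq_left.mpr (Subgroup.zpowers_le.mpr hu)] at this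
    exact hx this
  obtain ⟨a, ha, hxa⟩ := hM (Subgroup.center X) inferInstance (Group.IsNilpotent.center_ne_bot X)
  obtain ⟨y, hy, z, hz, hyz⟩ := Subgroup.mem_sup_of_normal_right.mp hxa
  have hpowx : ∀ n : ℕ, x ^ (a * n) = y ^ n * z ^ n := fun n => by
    rw [pow_mul, ← hyz, Commute.mul_pow (Subgroup.mem_center_iff.mp hz y)]
  have hz1 : ∀ n, IsNumberFor C.coprimes n → z ^ n ≠ 1 := fun n hn h =>
    hx ⟨a * n, ha.mul hn, by rw [hpowx, h, mul_one]; exact pow_mem hy n⟩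
  have hzw : ∀ w ∈ Subgroup.center X, w ≠ 1 →
      ∃ n, IsNumberFor C.coprimes n ∧ z ^ n ∈ Subgroup.zpowers w := by
    intro w hw hw1
    have hwn := Subgroup.zpowers_normal_of_mem_center hw
    obtain ⟨n, hn, hxn⟩ := hM _ hwn (mt Subgroup.zpowers_eq_bot.mp hw1)
    obtain ⟨y', hy', v, hv, hyv⟩ := Subgroup.mem_sup_of_normal_right.mp hxn
    have hvc : v ∈ Subgroup.center X := Subgroup.zpowers_le.mpr hw hv
    refine ⟨n, hn, ?_⟩
    have h1 : y ^ n * z ^ n = y' ^ a * v ^ a := by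
      rw [← hpowx, mul_comm, pow_mul, ← hyv, Commute.mul_pow (Subgroup.mem_center_iff.mp hvc y')]
    -- Both sides lie in `Y` and in the center, hence are trivial, giving `z ^ n = v ^ a`.
    have h2 : (y' ^ a)⁻¹ * y ^ n = v ^ a * (z ^ n)⁻¹ := by
      rw [inv_mul_eq_iff_eq_mul, ← mul_assoc, ← h1, mul_inv_cancel_right]
    have h3 := hYZ _ (mul_mem (inv_mem (pow_mem hy' a)) (pow_mem hy n))
      (h2 ▸ mul_mem (pow_mem hvc a) (inv_mem (pow_mem hz n)))
    rw [h2, mul_inv_eq_one] at h3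
    exact h3 ▸ pow_mem hv a
  -- For `z` of infinite order, a power `z ^ n` in the subgroup generated by `z ^ p` would force `p
  -- ∣ n`.
  have hzfin : orderOf z ≠ 0 := by
    intro h0
    obtain ⟨p, hp⟩ := hC.exists_mem_primes
    have hzp : z ^ p ≠ 1 := fun h => by
      have := orderOf_dvd_of_pow_eq_one h
      rw [h0, zero_dvd_iff] at this
      exact hp.1.ne_zero this
    obtain ⟨n, hn, hmem⟩ := hzw _ (pow_mem hz p) hzp
    obtain ⟨k, hk⟩ := Subgroup.mem_zpowers_iff.mp hmem
    have hz0 : z ^ ((p : ℤ) * k - n) = 1 := by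
      rw [zpow_sub, zpow_mul, zpow_natCast, zpow_natCast, hk, mul_inv_cancel]
    have h1 := orderOf_dvd_iff_zpow_eq_one.mpr hz0
    rw [h0, Nat.cast_zero, zero_dvd_iff, sub_eq_zero] at h1
    have h2 : p ∣ n := Int.natCast_dvd_natCast.mp ⟨k, h1.symm⟩
    exact (hn.2 p hp.1 h2).2 hp
  obtain ⟨p, hp, hpz⟩ : ∃ p ∈ C.primes, p ∣ orderOf z := by
    by_contra! h
    exact hz1 (orderOf z) ⟨Nat.pos_of_ne_zero hzfin, fun p hp hpz => ⟨hp, fun h' => h p h' hpz⟩⟩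
      (pow_orderOf_eq_one z)
  have ht := orderOf_pow_orderOf_div hzfin hpz
  set t := z ^ (orderOf z / p)
  refine ⟨p, hp, fun w hw => exists_pow_prime_pow_eq_one_of_mem_zpowers hp.1 ht fun m hm => ?_⟩
  obtain ⟨n, hn, hmem⟩ := hzw _ (pow_mem hw m) hm
  have htn : t ^ n ∈ Subgroup.zpowers (w ^ m) := by
    rw [← pow_mul, mul_comm, pow_mul]
    exact pow_mem hmem _
  obtain ⟨j, hj⟩ := exists_pow_eq_self_of_coprime (x := t)
    (ht ▸ (coprime_of_isNumberFor_coprimes hp hn).symm)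
  exact hj ▸ pow_mem htn j

/-- Every element that is not a `C.coprimes`-root of a subgroup `Y` is separated from `Y`. -/
theorem IsBoundedNilpotent.exists_separating (hC : C.IsRoot) (hper : C.IsPeriodic) {X : Type u}
    [Group X] (hX : C.IsBoundedNilpotent X) {Y : Subgroup X} {x : X}
    (hx : x ∉ rootsFor C.coprimes Y) :
    ∃ (G : Type u) (_ : Group G) (σ : X →* G),
      C.Mem G ∧ Function.Surjective σ ∧ σ x ∉ Y.map σ := by
  -- Zorn applies because being a root involves a single element of the union of a chain, hence a
  -- single member.
  obtain ⟨N, -, ⟨hN, hxN⟩, hmax⟩ := zorn_le_nonempty₀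
    {N : Subgroup X | N.Normal ∧ x ∉ rootsFor C.coprimes (Y ⊔ N)} (fun c hc hchain N hNc => by
      have hn := Subgroup.sSup_normal c fun H hH => (hc hH).1
      refine ⟨sSup c, ⟨hn, ?_⟩, fun H hH => le_sSup hH⟩
      rintro ⟨n, hn, hxn⟩
      obtain ⟨y, hy, m, hm, hym⟩ := Subgroup.mem_sup_of_normal_right.mp hxn
      obtain ⟨H, hH, hmH⟩ := (Subgroup.mem_sSup_of_directedOn ⟨N, hNc⟩ hchain.directedOn).mp hm
      exact (hc hH).2 ⟨n, hn, hym ▸ Subgroup.mul_mem_sup hy hmH⟩) ⊥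
    ⟨inferInstance, by rwa [sup_bot_eq]⟩
  set σ := QuotientGroup.mk' N with hσ
  have hsurj : Function.Surjective σ := QuotientGroup.mk'_surjective N
  have hcomap : (Y.map σ).comap σ = Y ⊔ N := by
    rw [Subgroup.comap_map_eq, hσ, QuotientGroup.ker_mk']
  have hX' := hX.of_surjective σ hsurj
  have := hX'.1
  have hσx : σ x ∉ rootsFor C.coprimes (Y.map σ) := by
    rintro ⟨n, hn, h⟩
    refine hxN ⟨n, hn, ?_⟩
    rwa [← map_pow, ← Subgroup.mem_comap, hcomap] at h
  obtain ⟨p, hp, htor⟩ := hC.exists_center_torsion hσx fun M hM hne => by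
    by_contra hxM
    have hNM : N ≤ M.comap σ := fun g hg => by
      rw [Subgroup.mem_comap, hσ, QuotientGroup.mk'_apply, (QuotientGroup.eq_one_iff g).mpr hg]
      exact one_mem M
    have hle := hmax ⟨hM.comap σ, fun ⟨n, hn, h⟩ => hxM ⟨n, hn, by
      have h' := Subgroup.mem_map_of_mem σ h
      rwa [Subgroup.map_sup, Subgroup.map_comap_eq_self_of_surjective hsurj, map_pow] at h'⟩⟩ hNM
    refine hne (eq_bot_iff.mpr fun m hm => ?_)
    obtain ⟨g, rfl⟩ := hsurj m
    exact Subgroup.mem_bot.mpr ((QuotientGroup.eq_one_iff g).mpr (hle hm))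
  exact ⟨_, _, σ, hX'.mem_of_center hC hper hp htor, hsurj, fun h => hσx (mem_rootsFor_of_mem h)⟩

theorem IsBoundedNilpotent.hasSep (hC : C.IsRoot) (hper : C.IsPeriodic) {X : Type u} [Group X]
    (hX : C.IsBoundedNilpotent X) : C.HasSep X := fun _ hY _ hx =>
  hX.exists_separating hC hper fun ⟨_, hn, h⟩ => hx (hY.mem_of_pow_mem hn h)

end GroupClass

theorem theorem2p2 (C : GroupClass.{u}) (hroot : C.IsRoot) (hper : C.IsPeriodic)
    (X : Type u) [Group X] (hX : C.IsBoundedNilpotent X) :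
    (∀ Y : Subgroup X,
      C.IsSeparable (isolatorFor C.coprimes Y) ∧
      (isolatorFor C.coprimes Y : Set X) = rootsFor C.coprimes Y ∧
      (HasNoTorsionFor C.coprimes X →
        Group.nilpotencyClass (isolatorFor C.coprimes Y) = Group.nilpotencyClass Y)) ∧
    C.HasSep X := by
  have := hX.1
  have hQ : ∀ q ∈ C.coprimes, q.Prime := fun q hq => hq.1
  have hsep := hX.hasSep hroot hper
  exact ⟨fun Y => ⟨hsep _ (isIsolatedFor_isolatorFor _ Y), coe_isolatorFor_eq_rootsFor hQ Y,
    fun htf => nilpotencyClass_isolatorFor hQ htf Y⟩, hsep⟩
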